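/- Consider a single-server FIFO queue with abandonment on a probability space. Customers arrive one at a time according to a homogeneous Poisson process $A(\cdot)$ on $[0,\infty)$ with rate $\lambda>0$ (a counting process, started at $0$, with i.i.d. exponential($\lambda$) interarrival times), and $T_k=\inf\{t>0:A(t)=k\}$ is the arrival time of customer $k\ge 1$. Customer $k$ has service time $V_k$ and patience $D_k=\alpha^{-1}\tilde D_k$, $\alpha>0$. The $V_k\ge 0$ are i.i.d. with mean $1/\mu\in(0,\infty)$ and finite variance; the $\tilde D_k\ge 0$ are i.i.d. with mean $1$ and distribution function $F$ that is twice continuously differentiable on $[0,\infty)$ (one-sidedly at $0$, so that the density at $0$ is finite) and has support $[0,\infty)$. Put $\bar F_\alpha(x)=1-F(\alpha x)=\mathbb P(D_1>x)$. Let $Z(\cdot)$ be the virtual waiting time process and $W_k=Z(T_k-)$ the waiting time offered to customer $k$, who is served if and only if $D_k>W_k$. Let $$A_0(t)=\sum_{k=1}^{A(t)}\mathbf 1\{D_k>W_k\},\qquad Y(t)=\sum_{k=1}^{A(t)}V_k\mathbf 1\{D_k>W_k\},\qquad N(t)=Y(t)-t .$$ From its initial value $Z(0)$, the virtual waiting time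 evolves for $t\ge 0$ as the reflection of the effective net input, $$Z(t)=\max\Bigl\{Z(0)+N(t),\ \sup_{0\le s\le t}\bigl(N(t)-N(t-s)\bigr)\Bigr\},$$ which is $Z(t)=\sup_{0\le s\le t}(N(t)-N(t-s))$ when the system starts empty, $Z(0)=0$. The initial value $Z(0)$ (possibly the constant $0$), the arrival process $A(\cdot)$, the sequence $(V_k)$ and the sequence $(\tilde D_k)$ are mutually independent. Then for all $0\le s\le t$ the random variables below are well defined and integrable, and $$\mathbb E[A_0(t)-A_0(t-s)]=\lambda\,\mathbb E\Bigl[\int_{t-s}^t\bar F_\alpha(Z(u-))\,du\Bigr],$$ $$\mathbb E[N(t)-N(t-s)]=\frac{\lambda}{\mu}\,\mathbb E\Bigl[\int_{t-s}^t\bar F_\alpha(Z(u-))\,du\Bigr]-s .$$ Moreover, if $Z$ is the restriction to $[0,\infty)$ of a process $\{Z(u)\}_{u\in\mathbb R}$ that is strictly stationary and whose left limit $Z(0-)$ exists almost surely, then for all $0\le s\le t$ $$\mathbb E[A_0(t)-A_0(t-s)]=\lambda s\,\mathbb E[\bar F_\alpha(Z(0-))],\qquad \mathbb E[N(t)-N(t-s)]=\Bigl(\frac{\lambda}{\mu}\,\mathbb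 E[\bar F_\alpha(Z(0-))]-1\Bigr)s .$$ -/

import Mathlib

open MeasureTheory ProbabilityTheory Set Filter Topology

noncomputable section

namespace AbandonmentQueue

variable {Ω : Type*}

/-- The left limit `X(u-)` of a real-valued process on the time axis `ℝ`. -/
def leftLimit (X : ℝ → Ω → ℝ) (u : ℝ) (ω : Ω) : ℝ :=
  Function.leftLim (fun v => X v ω) u

/-- Paths of a counting process on `[0, ∞)` whose points arrive one at a time: started at `0`,
nondecreasing, right-continuous, skipping no integer value. -/
structure IsCountingPath (a : ℝ → ℕ) : Prop where
  zero : a 0 = 0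
  mono : MonotoneOn a (Ici 0)
  rightCont : ∀ t, 0 ≤ t → ContinuousWithinAt a (Ici t) t
  oneAtATime : ∀ t, 0 ≤ t → ∀ k ≤ a t, ∃ u ∈ Icc 0 t, a u = k

/-- The arrival time `T_k = inf {t > 0 : A(t) = k}` of the `k`-th customer, `k ≥ 1`
(for `k = 0` the value is `0`, as `A` vanishes just after time `0`). -/
def arrivalTime (A : ℝ → Ω → ℕ) (k : ℕ) (ω : Ω) : ℝ :=
  sInf {t : ℝ | 0 < t ∧ A t ω = k}

/-- The `(k+1)`-st interarrival time `T_{k+1} - T_k` (with `T_0 = 0`). -/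
def interarrival (A : ℝ → Ω → ℕ) (k : ℕ) (ω : Ω) : ℝ :=
  arrivalTime A (k + 1) ω - arrivalTime A k ω

/-- `A` is a homogeneous Poisson process on `[0, ∞)` with rate `lam`: a counting process whose
interarrival times are i.i.d. exponential with rate `lam`. -/
structure IsPoissonProcess [MeasurableSpace Ω] (A : ℝ → Ω → ℕ) (lam : ℝ) (P : Measure Ω) :
    Prop where
  measurable : ∀ t, 0 ≤ t → Measurable (A t)
  path : ∀ ω, IsCountingPath (fun t => A t ω)
  indep : iIndepFun (interarrival A) P
  law : ∀ k, P.map (interarrival A k) = expMeasure lam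

/-- The waiting time `Z(T-)` offered to customer number `k + 1`, who arrives at `T = T_{k+1}`. -/
def offeredWait (A : ℝ → Ω → ℕ) (Z : ℝ → Ω → ℝ) (k : ℕ) (ω : Ω) : ℝ :=
  leftLimit Z (arrivalTime A (k + 1) ω) ω

open Classical in
/-- The effective arrival process `A₀(t)`: the number of customers arriving in `(0, t]` whose
patience exceeds their offered waiting time. Customer number `k + 1` has patience `D k`. -/
def effArrivals (A : ℝ → Ω → ℕ) (D : ℕ → Ω → ℝ) (Z : ℝ → Ω → ℝ) (t : ℝ) (ω : Ω) : ℝ :=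
  ∑ k ∈ Finset.range (A t ω), if offeredWait A Z k ω < D k ω then 1 else 0

open Classical in
/-- The effective total input `Y(t)`: the work brought in `(0, t]` by the customers who do not
abandon. Customer number `k + 1` has service time `V k` and patience `D k`. -/
def effInput (A : ℝ → Ω → ℕ) (V D : ℕ → Ω → ℝ) (Z : ℝ → Ω → ℝ) (t : ℝ) (ω : Ω) : ℝ :=
  ∑ k ∈ Finset.range (A t ω), if offeredWait A Z k ω < D k ω then V k ω else 0

/-- The effective net input `N(t) = Y(t) - t`. -/
def netInput (A : ℝ → Ω → ℕ) (V D : ℕ → Ω → ℝ) (Z : ℝ → Ω → ℝ) (t : ℝ) (ω : Ω) : ℝ :=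
  effInput A V D Z t ω - t

/-- `Z` is, on `[0, ∞)`, a path of the virtual waiting time of the queue with initial value `Z 0`:
the reflection of the effective net input,
`Z(t) = max (Z(0) + N(t)) (sup_{0 ≤ s ≤ t} (N(t) - N(t - s)))`.
As `N(0) = 0`, for `Z(0) = 0` (system starting empty) this is
`Z(t) = sup_{0 ≤ s ≤ t} (N(t) - N(t - s))`. The equation is recursive, as `N` up to time `t`
involves the values of `Z` before `t`; it determines `Z` on `[0, ∞)` from `Z(0)`, arrival by
arrival. -/
def IsVirtualWait (A : ℝ → Ω → ℕ) (V D : ℕ → Ω → ℝ) (Z : ℝ → Ω → ℝ) (ω : Ω) : Prop :=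
  ∀ t, 0 ≤ t → Z t ω = max (Z 0 ω + netInput A V D Z t ω)
    (sSup ((fun s => netInput A V D Z t ω - netInput A V D Z (t - s) ω) '' Icc 0 t))

/-- The complementary distribution function `1 - F(α x)` of the patience `α⁻¹ D̃`, where `F` is the
distribution function of the law `ν` of `D̃`. -/
def patienceTail (ν : Measure ℝ) (α x : ℝ) : ℝ :=
  1 - cdf ν (α * x)

/-- Strict stationarity of a process on the time axis `ℝ`. -/
def StrictlyStationary [MeasurableSpace Ω] (Z : ℝ → Ω → ℝ) (P : Measure Ω) : Prop :=
  ∀ (n : ℕ) (u : Fin n → ℝ) (h : ℝ),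
    IdentDistrib (fun ω i => Z (u i + h) ω) (fun ω i => Z (u i) ω) P P

/-- The standing assumptions on the queue with Poisson arrivals. The service times are `V k`, the
patience times are `α⁻¹ * Dt k`. -/
structure IsPoissonQueue [MeasurableSpace Ω] (P : Measure Ω) (lam μ α : ℝ) (A : ℝ → Ω → ℕ)
    (V Dt : ℕ → Ω → ℝ) (Z : ℝ → Ω → ℝ) : Prop where
  lam_pos : 0 < lam
  mu_pos : 0 < μ
  alpha_pos : 0 < α
  poisson : IsPoissonProcess A lam P
  /-- service times: nonnegative, i.i.d., of mean `1 / μ` and finite variance -/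
  V_measurable : ∀ k, Measurable (V k)
  V_nonneg : ∀ k, 0 ≤ᵐ[P] V k
  V_indep : iIndepFun V P
  V_ident : ∀ k, IdentDistrib (V k) (V 0) P P
  V_mean : ∫ ω, V 0 ω ∂P = 1 / μ
  V_memLp : MemLp (V 0) 2 P
  /-- unscaled patience times: nonnegative, i.i.d., of mean `1`, with a distribution function that
  is twice continuously differentiable on `[0, ∞)` (one-sidedly at `0`, so that the density at `0`
  is finite) and with support `[0, ∞)` -/
  Dt_measurable : ∀ k, Measurable (Dt k)
  Dt_nonneg : ∀ k, 0 ≤ᵐ[P] Dt k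
  Dt_indep : iIndepFun Dt P
  Dt_ident : ∀ k, IdentDistrib (Dt k) (Dt 0) P P
  Dt_mean : ∫ ω, Dt 0 ω ∂P = 1
  Dt_cdf : ContDiffOn ℝ 2 (fun x => cdf (P.map (Dt 0)) x) (Ici 0)
  Dt_support : (P.map (Dt 0)).support = Ici 0
  /-- the virtual waiting time, from an initial value `Z(0)` (the constant `0` if the system starts
  empty) -/
  Z_measurable : Measurable (Z 0)
  Z_virtualWait : ∀ᵐ ω ∂P, IsVirtualWait A V (fun k ω => α⁻¹ * Dt k ω) Z ω
  /-- the initial value, the arrival process, the service times and the patience times are mutually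
  independent -/
  indep : iIndep
    ![MeasurableSpace.comap (Z 0) inferInstance,
      ⨆ t : Ici (0 : ℝ), MeasurableSpace.comap (A t) inferInstance,
      ⨆ k : ℕ, MeasurableSpace.comap (V k) inferInstance,
      ⨆ k : ℕ, MeasurableSpace.comap (Dt k) inferInstance] P

end AbandonmentQueue

end

/-!
Between the `k`-th and the `(k+1)`-st arrival the virtual waiting time decreases at unit rate until
it hits `0`. Hence, given the past up to the arrival time `T_k`, the waiting time offered to the next
customer is the function `x ↦ max (Z(T_k) - x) 0` of the interarrival time `τ ∼ Exp(lam)`, which is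
independent of that past, and the patience of that customer is independent of both. For one
exponential time, `𝔼 f(τ) = lam 𝔼 ∫_0^τ f(x) dx`
(`lintegral_expMeasure_eq_lintegral_compensator`). With
`f(x) = g(T_k + x) F̄_α(max (Z(T_k) - x) 0)` this says that the next customer contributes to the mean
of the effective arrivals, weighted by `g` at the arrival epoch, the constant `lam` times the mean
integral of `g(u) F̄_α(Z(u-))` over `(T_k, T_{k+1}]` (`IsPoissonQueue.lintegral_served`). Summing over
`k`, with `g` the indicator function of `(t - s, t]`, gives the identity for `A₀`, and it bounds the
mean by `lam * s`, so that no separate moment bound for the Poisson process is needed. The service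
time is independent of the arrival epoch and of the decision to join, whence the factor `1 / μ` for
the effective input.

The process `Z` is given only through the reflection equation, outside a null set, and is not assumed
measurable after time `0`. The integrals are therefore computed for the queue embedded at arrival
epochs (`embeddedWait`, `serveProb`), which is measurable with respect to the driving variables by
its recursion; `IsRegularOutcome.eq_embeddedWait` and `IsRegularOutcome.serveProb_eq` identify it
with `Z` almost surely. The path description comes from `reflection_between_arrivals`.

If `Z` is stationary, bounded convergence along times increasing to `u` shows that
`𝔼 F̄_α(Z(u-)) = 𝔼 F̄_α(Z(0))` wherever the left limit exists almost surely, that is, for `u = 0` by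
assumption and for `u > 0` by the path description; it remains to exchange the expectation with the
integral over `u`.
-/

namespace AbandonmentQueue

open scoped ENNReal

/-! ### Counting paths and their arrival times -/

section CountingPath

variable {a : ℝ → ℕ}

/-- By right-continuity an integer-valued path is constant just after each time. -/
theorem IsCountingPath.exists_Ico_eq (ha : IsCountingPath a) {t : ℝ} (ht : 0 ≤ t) :
    ∃ u, t < u ∧ ∀ x ∈ Ico t u, a x = a t := by
  have h : ∀ᶠ x in 𝓝[≥] t, a x = a t := by
    have := (ha.rightCont t ht).tendsto
    rw [nhds_discrete] at this
    exact tendsto_pure.1 this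
  obtain ⟨u, hu, hsub⟩ := mem_nhdsGE_iff_exists_Ico_subset.1 h
  exact ⟨u, hu, fun x hx => hsub hx⟩

theorem IsCountingPath.sInf_zero (ha : IsCountingPath a) :
    sInf {t : ℝ | 0 < t ∧ a t = 0} = 0 := by
  obtain ⟨u, hu, hconst⟩ := ha.exists_Ico_eq le_rfl
  refine le_antisymm (le_of_forall_pos_le_add fun ε hε => ?_)
    (Real.sInf_nonneg fun x hx => hx.1.le)
  have hpos : 0 < min ε (u / 2) := lt_min hε (by linarith)
  have hmem : min ε (u / 2) ∈ {t : ℝ | 0 < t ∧ a t = 0} := by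
    refine ⟨hpos, ?_⟩
    rw [hconst _ ⟨hpos.le, (min_le_right _ _).trans_lt (by linarith)⟩, ha.zero]
  have := csInf_le ⟨0, fun x hx => hx.1.le⟩ hmem
  linarith [min_le_left ε (u / 2)]

theorem IsCountingPath.sInf_le_of_le (ha : IsCountingPath a) {k : ℕ} {t : ℝ} (ht : 0 ≤ t)
    (hk : k ≤ a t) : sInf {t : ℝ | 0 < t ∧ a t = k} ≤ t := by
  obtain ⟨u, hu, huk⟩ := ha.oneAtATime t ht k hk
  rcases hu.1.eq_or_lt with rfl | hpos
  · rw [ha.zero] at huk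
    subst huk
    rw [ha.sInf_zero]
    exact ht
  · exact (csInf_le (s := {t : ℝ | 0 < t ∧ a t = k}) ⟨0, fun x hx => hx.1.le⟩
      ⟨hpos, huk⟩).trans hu.2

theorem IsCountingPath.sInf_le_iff (ha : IsCountingPath a) {k : ℕ}
    (hne : {t : ℝ | 0 < t ∧ a t = k}.Nonempty) {t : ℝ} (ht : 0 ≤ t) :
    sInf {t : ℝ | 0 < t ∧ a t = k} ≤ t ↔ k ≤ a t := by
  refine ⟨fun h => ?_, ha.sInf_le_of_le ht⟩
  have h0 : 0 ≤ sInf {t : ℝ | 0 < t ∧ a t = k} := Real.sInf_nonneg fun x hx => hx.1.le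
  -- by right-continuity the infimum is attained
  obtain ⟨u, hu, hconst⟩ := ha.exists_Ico_eq h0
  obtain ⟨s, hs, hsu⟩ := exists_lt_of_csInf_lt hne hu
  have := hconst s ⟨csInf_le ⟨0, fun x hx => hx.1.le⟩ hs, hsu⟩
  rw [hs.2] at this
  rw [this]
  exact ha.mono h0 ht h

end CountingPath

section ArrivalTime

variable {Ω : Type*} {A : ℝ → Ω → ℕ} {ω : Ω}

theorem arrivalTime_zero (ha : IsCountingPath fun t => A t ω) : arrivalTime A 0 ω = 0 :=
  ha.sInf_zero

theorem arrivalTime_nonneg (k : ℕ) : 0 ≤ arrivalTime A k ω :=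
  Real.sInf_nonneg fun _ hx => hx.1.le

theorem arrivalTime_succ (k : ℕ) :
    arrivalTime A (k + 1) ω = arrivalTime A k ω + interarrival A k ω := by
  simp [interarrival]

theorem strictMono_arrivalTime (hpos : ∀ k, 0 < interarrival A k ω) :
    StrictMono fun k => arrivalTime A k ω :=
  strictMono_nat_of_lt_succ fun k => sub_pos.1 (hpos k)

theorem arrivalTime_le_iff (ha : IsCountingPath fun t => A t ω)
    (hpos : ∀ k, 0 < interarrival A k ω) {t : ℝ} (ht : 0 ≤ t) (k : ℕ) :
    arrivalTime A k ω ≤ t ↔ k ≤ A t ω := by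
  rcases Nat.eq_zero_or_pos k with rfl | hk
  · simpa [arrivalTime_zero ha] using ht
  · refine ha.sInf_le_iff (nonempty_iff_ne_empty.2 fun h => ?_) ht
    -- otherwise the arrival time would be the infimum of the empty set, which is `0`
    have h1 := strictMono_arrivalTime hpos hk
    have h2 : arrivalTime A k ω = 0 := by rw [arrivalTime, h, Real.sInf_empty]
    have h3 := arrivalTime_nonneg (A := A) (ω := ω) 0
    simp only [h2] at h1
    linarith

/-- The arrival times are measurable with respect to the arrival process. -/
theorem measurable_arrivalTime (hA : ∀ ω, IsCountingPath fun t => A t ω) (k : ℕ) :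
    Measurable[⨆ t : Ici (0 : ℝ), MeasurableSpace.comap (A t) inferInstance]
      (arrivalTime A k) := by
  let m : MeasurableSpace Ω := ⨆ t : Ici (0 : ℝ), MeasurableSpace.comap (A t) inferInstance
  have hAm : ∀ t, 0 ≤ t → Measurable[m] (A t) := fun t ht =>
    (comap_measurable (A t)).mono
      (le_iSup (fun t : Ici (0 : ℝ) => MeasurableSpace.comap (A t) inferInstance) ⟨t, ht⟩) le_rfl
  refine @measurable_of_Iic ℝ Ω _ _ _ m _ _ _ _ fun t => ?_
  rcases lt_or_ge t 0 with ht | ht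
  · convert @MeasurableSet.empty Ω m
    ext ω
    simpa using ht.trans_le (arrivalTime_nonneg k)
  -- on paths that never reach `k` the arrival time has the value `0`
  have h : arrivalTime A k ⁻¹' Iic t
      = {ω | k ≤ A t ω} ∪ ⋂ n : ℕ, {ω | A n ω < k} := by
    ext ω
    simp only [mem_preimage, mem_Iic, mem_union, mem_iInter, mem_ofPred_eq]
    by_cases hne : {t : ℝ | 0 < t ∧ A t ω = k}.Nonempty
    · rw [arrivalTime, (hA ω).sInf_le_iff hne ht, or_iff_left]
      rintro hlt
      obtain ⟨s, hs, hsk⟩ := hne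
      obtain ⟨n, hn⟩ := exists_nat_ge s
      exact absurd (hlt n) (not_lt.2 (hsk ▸ (hA ω).mono hs.le (hs.le.trans hn) hn))
    · rw [arrivalTime, not_nonempty_iff_eq_empty.1 hne, Real.sInf_empty]
      refine iff_of_true ht ?_
      by_cases hk : k = 0
      · exact Or.inl (hk ▸ Nat.zero_le _)
      · refine Or.inr fun n => not_le.1 fun hle => hne ?_
        obtain ⟨u, hu, huk⟩ := (hA ω).oneAtATime n (Nat.cast_nonneg n) k hle
        refine ⟨u, hu.1.lt_of_ne ?_, huk⟩
        rintro rfl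
        exact hk (huk.symm.trans (hA ω).zero)
  rw [h]
  refine @MeasurableSet.union Ω m _ _ (hAm t ht measurableSet_Ici)
    (@MeasurableSet.iInter Ω ℕ m _ _ fun n => hAm n (Nat.cast_nonneg n) measurableSet_Iio)

end ArrivalTime

/-! ### Paths of the reflected net input between arrivals -/

section Reflection

variable {T c : ℕ → ℝ} {a : ℝ → ℕ} {z N : ℝ → ℝ}

/-- The reflection `z` of `N` is the least function with `z t - N t` above `z 0` and above `-N u`
for all `u ∈ [0, t]`. -/
theorem reflection_bounds (hNle : ∀ u, 0 ≤ u → -N u ≤ u)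
    (hz : ∀ t, 0 ≤ t →
      z t = max (z 0 + N t) (sSup ((fun s => N t - N (t - s)) '' Icc 0 t)))
    {t : ℝ} (ht : 0 ≤ t) :
    z 0 + N t ≤ z t ∧ (∀ u ∈ Icc 0 t, N t - N u ≤ z t) ∧
      ∀ C, z 0 ≤ C → (∀ u ∈ Icc 0 t, -N u ≤ C) → z t ≤ C + N t := by
  refine ⟨(le_max_left _ _).trans_eq (hz t ht).symm, fun u hu => ?_, fun C hC0 hC => ?_⟩
  · rw [hz t ht]
    refine le_max_of_le_right (le_csSup ⟨N t + t, ?_⟩ ⟨t - u, ⟨by linarith [hu.2], by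
      linarith [hu.1]⟩, by simp⟩)
    rintro _ ⟨s, hs, rfl⟩
    have := hNle (t - s) (by linarith [hs.2])
    simp only
    linarith [hs.1]
  · rw [hz t ht]
    refine max_le (by linarith) (csSup_le ((nonempty_Icc.2 ht).image _) ?_)
    rintro _ ⟨s, hs, rfl⟩
    have := hC (t - s) ⟨by linarith [hs.2], by linarith [hs.1]⟩
    simp only
    linarith

variable (hT0 : T 0 = 0) (hT : StrictMono T) (ha : ∀ t, 0 ≤ t → ∀ k, T k ≤ t ↔ k ≤ a t)
  (hc : ∀ k, 0 ≤ c k) (hN : ∀ t, N t = ∑ k ∈ Finset.range (a t), c k - t)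
  (hz : ∀ t, 0 ≤ t → z t = max (z 0 + N t) (sSup ((fun s => N t - N (t - s)) '' Icc 0 t)))

include hT0 hT ha hc hN hz

/-- Between two arrivals the reflected path decreases at unit rate until it hits `0`; at an arrival
it jumps by the work brought in. -/
theorem reflection_between_arrivals (k : ℕ) :
    (∀ t ∈ Ico (T k) (T (k + 1)), z t = max (z (T k) - (t - T k)) 0) ∧
      z (T (k + 1)) = max (z (T k) - (T (k + 1) - T k)) 0 + c k := by
  have hTk : 0 ≤ T k := hT0 ▸ hT.monotone (Nat.zero_le k)
  have hlt : T k < T (k + 1) := hT k.lt_succ_self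
  have hNle : ∀ u, 0 ≤ u → -N u ≤ u := fun u _ => by
    have := Finset.sum_nonneg fun i (_ : i ∈ Finset.range (a u)) => hc i
    rw [hN]; linarith
  have haeq : ∀ t ∈ Ico (T k) (T (k + 1)), a t = k := fun t ht => by
    have h1 := (ha t (hTk.trans ht.1) k).1 ht.1
    have h2 := mt (ha t (hTk.trans ht.1) (k + 1)).2 (not_le.2 ht.2)
    omega
  have haeq' : a (T (k + 1)) = k + 1 := by
    have h0 := hTk.trans hlt.le
    have h1 := (ha _ h0 (k + 1)).1 le_rfl
    have h2 := mt (ha _ h0 (k + 2)).2 (not_le.2 (hT (Nat.lt_succ_self (k + 1))))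
    omega
  have hNt : ∀ t ∈ Ico (T k) (T (k + 1)), N t = N (T k) - (t - T k) := fun t ht => by
    rw [hN, hN, haeq t ht, haeq (T k) ⟨le_rfl, hlt⟩]; ring
  have hNT : N (T (k + 1)) = N (T k) - (T (k + 1) - T k) + c k := by
    rw [hN, hN, haeq', haeq (T k) ⟨le_rfl, hlt⟩, Finset.sum_range_succ]; ring
  obtain ⟨b1, b2, b3⟩ := reflection_bounds hNle hz hTk
  constructor
  · intro t ht
    obtain ⟨e1, e2, e3⟩ := reflection_bounds hNle hz (hTk.trans ht.1)
    have hn := hNt t ht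
    refine le_antisymm ?_ (max_le ?_ ?_)
    · have := e3 (max (z (T k) - (t - T k)) 0 - N t) ?_ fun u hu => ?_
      · linarith
      · linarith [le_max_left (z (T k) - (t - T k)) 0]
      · rcases le_total u (T k) with huk | huk
        · linarith [b2 u ⟨hu.1, huk⟩, le_max_left (z (T k) - (t - T k)) 0]
        · rw [hNt u ⟨huk, hu.2.trans_lt ht.2⟩]
          linarith [le_max_right (z (T k) - (t - T k)) 0, hu.2]
    · have := b3 (z t - N t) (by linarith) fun u hu => by
        linarith [e2 u ⟨hu.1, hu.2.trans ht.1⟩]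
      linarith
    · linarith [e2 t ⟨hTk.trans ht.1, le_rfl⟩]
  · obtain ⟨e1, e2, e3⟩ := reflection_bounds hNle hz (hTk.trans hlt.le)
    refine le_antisymm ?_ ?_
    · have := e3 (max (z (T k) - (T (k + 1) - T k)) 0 + c k - N (T (k + 1))) ?_ fun u hu => ?_
      · linarith
      · linarith [le_max_left (z (T k) - (T (k + 1) - T k)) 0]
      · rcases le_total u (T k) with huk | huk
        · linarith [b2 u ⟨hu.1, huk⟩, le_max_left (z (T k) - (T (k + 1) - T k)) 0]
        · rcases hu.2.eq_or_lt with rfl | hlt'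
          · linarith [le_max_right (z (T k) - (T (k + 1) - T k)) 0, hc k]
          · rw [hNt u ⟨huk, hlt'⟩]
            linarith [le_max_right (z (T k) - (T (k + 1) - T k)) 0, hu.2]
    · rw [← le_sub_iff_add_le]
      refine max_le ?_ ?_
      · have := b3 (z (T (k + 1)) - N (T (k + 1))) (by linarith) fun u hu => by
          linarith [e2 u ⟨hu.1, hu.2.trans hlt.le⟩]
        linarith
      · -- the supremum over `[T k, T (k + 1))` is approached at the right end, not attained
        refine le_of_forall_pos_le_add fun ε hε => ?_
        have hu : max (T k) (T (k + 1) - ε) ∈ Ico (T k) (T (k + 1)) :=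
          ⟨le_max_left _ _, max_lt hlt (by linarith)⟩
        have := e2 _ ⟨hTk.trans hu.1, hu.2.le⟩
        rw [hNt _ hu] at this
        linarith [le_max_right (T k) (T (k + 1) - ε)]

theorem tendsto_reflection_left (k : ℕ) {u : ℝ} (hu : u ∈ Ioc (T k) (T (k + 1))) :
    Tendsto z (𝓝[<] u) (𝓝 (max (z (T k) - (u - T k)) 0)) := by
  have hcont : Tendsto (fun x => max (z (T k) - (x - T k)) 0) (𝓝[<] u)
      (𝓝 (max (z (T k) - (u - T k)) 0)) :=
    (Continuous.tendsto (by fun_prop) u).mono_left nhdsWithin_le_nhds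
  refine hcont.congr' ?_
  filter_upwards [Ioo_mem_nhdsLT hu.1] with x hx
  exact ((reflection_between_arrivals hT0 hT ha hc hN hz k).1 x
    ⟨hx.1.le, hx.2.trans_le hu.2⟩).symm

end Reflection

/-! ### Two integral identities -/

section Integrals

/-- Integration against the joint law of two independent random variables. -/
theorem lintegral_comp_of_indepFun {Ω E F : Type*} [MeasurableSpace Ω] [MeasurableSpace E]
    [MeasurableSpace F] {P : Measure Ω} [IsProbabilityMeasure P] {X : Ω → E} {Y : Ω → F}
    (hXY : IndepFun X Y P) (hX : Measurable X) (hY : Measurable Y) {f : E × F → ℝ≥0∞}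
    (hf : Measurable f) :
    ∫⁻ ω, f (X ω, Y ω) ∂P = ∫⁻ ω, ∫⁻ y, f (X ω, y) ∂(P.map Y) ∂P := by
  have := Measure.isProbabilityMeasure_map (μ := P) hY.aemeasurable
  rw [← lintegral_map hf (hX.prodMk hY),
    (indepFun_iff_map_prod_eq_prod_map_map hX.aemeasurable hY.aemeasurable).1 hXY,
    lintegral_prod _ hf.aemeasurable, lintegral_map hf.lintegral_prod_right' hX]

theorem expMeasure_Ioi {lam : ℝ} (hlam : 0 < lam) {x : ℝ} (hx : 0 ≤ x) :
    expMeasure lam (Ioi x) = ENNReal.ofReal (Real.exp (-(lam * x))) := by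
  have := isProbabilityMeasure_expMeasure hlam
  rw [← compl_Iic, prob_compl_eq_one_sub measurableSet_Iic, ← ofReal_cdf,
    cdf_expMeasure_eq hlam, if_pos hx, ← ENNReal.ofReal_one, ← ENNReal.ofReal_sub]
  · congr 1; ring
  · simp [hlam.le, hx, mul_nonneg]

theorem expMeasure_Iic_zero {lam : ℝ} (hlam : 0 < lam) : expMeasure lam (Iic 0) = 0 := by
  have := isProbabilityMeasure_expMeasure hlam
  rw [← ofReal_cdf, cdf_expMeasure_eq hlam]
  simp

theorem lintegral_expMeasure {lam : ℝ} (hlam : 0 < lam) {f : ℝ → ℝ≥0∞} (hf : Measurable f) :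
    ∫⁻ x, f x ∂(expMeasure lam)
      = ENNReal.ofReal lam * ∫⁻ x in Ioi 0, ENNReal.ofReal (Real.exp (-(lam * x))) * f x := by
  have hpdf : Measurable (exponentialPDF lam) := (measurable_exponentialPDFReal lam).ennreal_ofReal
  change ∫⁻ x, f x ∂(volume.withDensity (exponentialPDF lam)) = _
  rw [lintegral_withDensity_eq_lintegral_mul _ hpdf hf,
    ← lintegral_const_mul _ (by fun_prop),
    ← lintegral_add_compl _ (measurableSet_Iio (a := (0 : ℝ))), compl_Iio,
    setLIntegral_congr Ioi_ae_eq_Ici.symm]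
  have h0 : ∫⁻ x in Iio 0, (exponentialPDF lam * f) x = 0 := by
    rw [setLIntegral_congr_fun (g := fun _ => 0) measurableSet_Iio, lintegral_zero]
    intro x hx
    simp [exponentialPDF_of_neg hx]
  rw [h0, zero_add]
  refine setLIntegral_congr_fun measurableSet_Ioi fun x hx => ?_
  simp only [Pi.mul_apply]
  rw [exponentialPDF_of_nonneg (le_of_lt hx), ENNReal.ofReal_mul hlam.le, mul_assoc]

/-- The compensator identity for one exponential time `τ`: the process `1 {τ ≤ x} - lam (x ∧ τ)`
has mean zero, also after integrating a deterministic function against it. -/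
theorem lintegral_expMeasure_eq_lintegral_compensator {lam : ℝ} (hlam : 0 < lam) {f : ℝ → ℝ≥0∞}
    (hf : Measurable f) :
    ∫⁻ x, f x ∂(expMeasure lam)
      = ENNReal.ofReal lam * ∫⁻ y, ∫⁻ x in Ioc 0 y, f x ∂volume ∂(expMeasure lam) := by
  have := isProbabilityMeasure_expMeasure hlam
  have hmeas : Measurable fun p : ℝ × ℝ => (Ioi p.2).indicator (fun _ => f p.2) p.1 := by
    have : (fun p : ℝ × ℝ => (Ioi p.2).indicator (fun _ => f p.2) p.1)
        = {p : ℝ × ℝ | p.2 < p.1}.indicator fun p => f p.2 := by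
      ext p; simp [indicator]
    rw [this]
    exact (by fun_prop : Measurable fun p : ℝ × ℝ => f p.2).indicator
      (measurableSet_lt measurable_snd measurable_fst)
  have h1 : ∀ y, ∫⁻ x in Ioc 0 y, f x = ∫⁻ x in Ioi 0, (Ioi x).indicator (fun _ => f x) y := by
    intro y
    rw [setLIntegral_congr Ioo_ae_eq_Ioc.symm, ← lintegral_indicator measurableSet_Ioo,
      ← lintegral_indicator measurableSet_Ioi]
    congr 1 with x
    by_cases h1 : 0 < x <;> by_cases h2 : x < y <;> simp [indicator, h1, h2]
  simp_rw [h1]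
  rw [lintegral_lintegral_swap hmeas.aemeasurable, lintegral_expMeasure hlam hf]
  congr 1
  refine setLIntegral_congr_fun measurableSet_Ioi fun x hx => ?_
  rw [lintegral_indicator measurableSet_Ioi, setLIntegral_const, expMeasure_Ioi hlam (le_of_lt hx),
    mul_comm]

theorem setLIntegral_Ioc_comp_add (f : ℝ → ℝ≥0∞) (t y : ℝ) :
    ∫⁻ x in Ioc 0 y, f (t + x) = ∫⁻ u in Ioc t (t + y), f u := by
  rw [← lintegral_indicator measurableSet_Ioc, ← lintegral_indicator measurableSet_Ioc,
    ← lintegral_add_left_eq_self (fun u => (Ioc t (t + y)).indicator f u) t]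
  congr 1 with x
  simp [indicator]

end Integrals

/-! ### The patience tail -/

section PatienceTail

variable {ν : Measure ℝ} {α : ℝ}

theorem patienceTail_nonneg (x : ℝ) : 0 ≤ patienceTail ν α x :=
  sub_nonneg.2 (cdf_le_one _ _)

theorem patienceTail_le_one (x : ℝ) : patienceTail ν α x ≤ 1 :=
  sub_le_self _ (cdf_nonneg _ _)

@[fun_prop]
theorem measurable_patienceTail : Measurable (patienceTail ν α) :=
  measurable_const.sub ((monotone_cdf ν).measurable.comp (measurable_const_mul α))

theorem measure_lt_inv_mul [IsProbabilityMeasure ν] (hα : 0 < α) (x : ℝ) :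
    ν {d | x < α⁻¹ * d} = ENNReal.ofReal (patienceTail ν α x) := by
  have : {d | x < α⁻¹ * d} = (Iic (α * x))ᶜ := by
    ext d
    simp [lt_inv_mul_iff₀ hα]
  rw [this, prob_compl_eq_one_sub measurableSet_Iic, ← ofReal_cdf, patienceTail,
    ENNReal.ofReal_sub _ (cdf_nonneg _ _), ENNReal.ofReal_one]

end PatienceTail

/-! ### Independence of the driving variables -/

section Drivers

variable {Ω : Type*} {A : ℝ → Ω → ℕ} {V Dt : ℕ → Ω → ℝ} {Z : ℝ → Ω → ℝ}

/-- The variables driving the queue: the initial value (block `0`, which has a single index), the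
interarrival times, the service times and the unscaled patience times. -/
noncomputable def driver (A : ℝ → Ω → ℕ) (V Dt : ℕ → Ω → ℝ) (Z : ℝ → Ω → ℝ) (i : Fin 4)
    (j : {n : ℕ // i = 0 → n = 0}) : Ω → ℝ :=
  ![Z 0, interarrival A j, V j, Dt j] i

/-- The index set of the driving variables. -/
abbrev DriverIndex : Type := (i : Fin 4) × {n : ℕ // i = 0 → n = 0}

/-- The σ-algebra generated by the driving variables with index in `S`. -/
noncomputable abbrev driverSigma (A : ℝ → Ω → ℕ) (V Dt : ℕ → Ω → ℝ) (Z : ℝ → Ω → ℝ)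
    (S : Set DriverIndex) :
    MeasurableSpace Ω :=
  ⨆ p ∈ S, MeasurableSpace.comap (driver A V Dt Z p.1 p.2) inferInstance

theorem measurable_driverSigma_driver {S : Set DriverIndex} {i : Fin 4}
    {j : {n : ℕ // i = 0 → n = 0}}
    (h : (⟨i, j⟩ : DriverIndex) ∈ S) :
    Measurable[driverSigma A V Dt Z S] (driver A V Dt Z i j) :=
  (comap_measurable _).mono
    (le_iSup₂ (f := fun (p : DriverIndex) (_ : p ∈ S) =>
      MeasurableSpace.comap (driver A V Dt Z p.1 p.2) inferInstance) ⟨i, j⟩ h) le_rfl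

theorem driverSigma_mono {S S' : Set DriverIndex} (h : S ⊆ S') :
    driverSigma A V Dt Z S ≤ driverSigma A V Dt Z S' :=
  biSup_mono fun _ hp => h hp

/-- The index of the `k`-th interarrival time (counted from `0`), which ends at the arrival of
customer `k + 1`. -/
def arrIdx (k : ℕ) : DriverIndex := ⟨1, k, by simp⟩

/-- The index of the service time of customer `k + 1`. -/
def servIdx (k : ℕ) : DriverIndex := ⟨2, k, by simp⟩

/-- The index of the patience time of customer `k + 1`. -/
def patIdx (k : ℕ) : DriverIndex := ⟨3, k, by simp⟩

/-- The indices of the initial value and of the variables of the first `k` customers. -/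
def pastIdx (k : ℕ) : Set DriverIndex := {p | p.1 = 0 ∨ (p.2 : ℕ) < k}

variable [MeasurableSpace Ω] {P : Measure Ω} {lam μ α : ℝ}

theorem IsPoissonQueue.measurableSpace_arrivals_le (hQ : IsPoissonQueue P lam μ α A V Dt Z) :
    (⨆ t : Ici (0 : ℝ), MeasurableSpace.comap (A t) inferInstance) ≤ ‹MeasurableSpace Ω› :=
  iSup_le fun t => (hQ.poisson.measurable t t.2).comap_le

theorem IsPoissonQueue.measurable_driver (hQ : IsPoissonQueue P lam μ α A V Dt Z) (i : Fin 4)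
    (j : {n : ℕ // i = 0 → n = 0}) : Measurable (driver A V Dt Z i j) := by
  have hT : ∀ k, Measurable (arrivalTime A k) := fun k =>
    (measurable_arrivalTime hQ.poisson.path k).mono hQ.measurableSpace_arrivals_le le_rfl
  fin_cases i
  · exact hQ.Z_measurable
  · exact (hT _).sub (hT _)
  · exact hQ.V_measurable _
  · exact hQ.Dt_measurable _

theorem IsPoissonQueue.driverSigma_le (hQ : IsPoissonQueue P lam μ α A V Dt Z)
    (S : Set DriverIndex) : driverSigma A V Dt Z S ≤ ‹MeasurableSpace Ω› :=
  iSup₂_le fun p _ => (hQ.measurable_driver p.1 p.2).comap_le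

/-- The driving variables are independent, within the four blocks and across them. -/
theorem IsPoissonQueue.iIndepFun_driver [IsProbabilityMeasure P]
    (hQ : IsPoissonQueue P lam μ α A V Dt Z) :
    iIndepFun (fun (p : DriverIndex) => driver A V Dt Z p.1 p.2) P := by
  refine iIndepFun_uncurry (X := driver A V Dt Z) hQ.measurable_driver ?_ fun i => ?_
  · rw [iIndepFun_iff_iIndep]
    refine iIndep_of_iIndep_of_le hQ.indep fun i => ?_
    rw [← measurable_iff_comap_le]
    refine @measurable_pi_lambda _ _ _ (_) _ _ fun j => ?_
    fin_cases i
    · exact comap_measurable _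
    · have hT := measurable_arrivalTime hQ.poisson.path
      exact @Measurable.sub _ _ _ _ _ (_) _ _ (hT _) (hT _)
    · exact (comap_measurable _).mono
        (le_iSup (fun k : ℕ => MeasurableSpace.comap (V k) inferInstance) (j : ℕ)) le_rfl
    · exact (comap_measurable _).mono
        (le_iSup (fun k : ℕ => MeasurableSpace.comap (Dt k) inferInstance) (j : ℕ)) le_rfl
  · fin_cases i
    · have : Subsingleton {n : ℕ // (0 : Fin 4) = 0 → n = 0} :=
        ⟨fun a b => Subtype.ext ((a.2 rfl).trans (b.2 rfl).symm)⟩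
      change iIndepFun (driver A V Dt Z 0) P
      exact iIndepFun.of_subsingleton
    · change iIndepFun (fun j : {n : ℕ // (1 : Fin 4) = 0 → n = 0} => interarrival A j) P
      exact hQ.poisson.indep.precomp Subtype.val_injective
    · change iIndepFun (fun j : {n : ℕ // (2 : Fin 4) = 0 → n = 0} => V j) P
      exact hQ.V_indep.precomp Subtype.val_injective
    · change iIndepFun (fun j : {n : ℕ // (3 : Fin 4) = 0 → n = 0} => Dt j) P
      exact hQ.Dt_indep.precomp Subtype.val_injective

theorem IsPoissonQueue.indepFun_driver [IsProbabilityMeasure P]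
    (hQ : IsPoissonQueue P lam μ α A V Dt Z) {E : Type*} [MeasurableSpace E] {X : Ω → E}
    {S : Set DriverIndex} (hX : Measurable[driverSigma A V Dt Z S] X) {p : DriverIndex}
    (hp : p ∉ S) : IndepFun X (driver A V Dt Z p.1 p.2) P := by
  have h := indep_iSup_of_disjoint (fun p : DriverIndex => (hQ.measurable_driver p.1 p.2).comap_le)
    hQ.iIndepFun_driver (disjoint_singleton_right.2 hp)
  rw [iSup_singleton] at h
  rw [IndepFun_iff_Indep]
  exact indep_of_indep_of_le_left h hX.comap_le

end Drivers

/-! ### The queue embedded at arrival epochs -/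

section Embedded

variable {Ω : Type*} {A : ℝ → Ω → ℕ} {V D Dt : ℕ → Ω → ℝ} {Z : ℝ → Ω → ℝ}

open Classical in
/-- The virtual waiting time just after the `k`-th arrival, computed from the driving variables by
the recursion of the queue (for `k = 0`: the initial value). -/
noncomputable def embeddedWait (A : ℝ → Ω → ℕ) (V D : ℕ → Ω → ℝ) (Z : ℝ → Ω → ℝ) : ℕ → Ω → ℝ
  | 0, ω => Z 0 ω
  | k + 1, ω => max (embeddedWait A V D Z k ω - interarrival A k ω) 0 +
      if max (embeddedWait A V D Z k ω - interarrival A k ω) 0 < D k ω then V k ω else 0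

/-- The waiting time offered to customer `k + 1`, in terms of the embedded queue. -/
noncomputable def embeddedOffer (A : ℝ → Ω → ℕ) (V D : ℕ → Ω → ℝ) (Z : ℝ → Ω → ℝ)
    (k : ℕ) (ω : Ω) : ℝ :=
  max (embeddedWait A V D Z k ω - interarrival A k ω) 0

/-- The set of outcomes for which customer `k + 1` is served, in terms of the embedded queue. -/
def servedSet (A : ℝ → Ω → ℕ) (V D : ℕ → Ω → ℝ) (Z : ℝ → Ω → ℝ) (k : ℕ) : Set Ω :=
  {ω | embeddedOffer A V D Z k ω < D k ω}

/-- The probability that a customer arriving at time `u > 0` is served, given the virtual waiting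
time just before `u`, as a jointly measurable function of the embedded queue. -/
noncomputable def serveProb (A : ℝ → Ω → ℕ) (V D : ℕ → Ω → ℝ) (Z : ℝ → Ω → ℝ) (F : ℝ → ℝ)
    (ω : Ω) (u : ℝ) : ℝ≥0∞ :=
  ∑' k, (Ioc (arrivalTime A k ω) (arrivalTime A (k + 1) ω)).indicator
    (fun u => ENNReal.ofReal (F (max (embeddedWait A V D Z k ω - (u - arrivalTime A k ω)) 0))) u

theorem embeddedWait_measurable_past {α : ℝ} (k : ℕ) :
    Measurable[driverSigma A V Dt Z (pastIdx k)]
      (embeddedWait A V (fun k ω => α⁻¹ * Dt k ω) Z k) := by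
  induction k with
  | zero =>
    exact measurable_driverSigma_driver (i := 0) (j := ⟨0, fun _ => rfl⟩) (Or.inl rfl)
  | succ k ih =>
    let m := driverSigma A V Dt Z (pastIdx (k + 1))
    have h0 : Measurable[m] (embeddedWait A V (fun k ω => α⁻¹ * Dt k ω) Z k) :=
      ih.mono (driverSigma_mono fun p hp => hp.imp id Nat.lt_succ_of_lt) le_rfl
    have h1 : Measurable[m] (interarrival A k) :=
      measurable_driverSigma_driver (i := 1) (j := ⟨k, by simp⟩) (Or.inr k.lt_succ_self)
    have h2 : Measurable[m] (V k) :=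
      measurable_driverSigma_driver (i := 2) (j := ⟨k, by simp⟩) (Or.inr k.lt_succ_self)
    have h3 : Measurable[m] (Dt k) :=
      measurable_driverSigma_driver (i := 3) (j := ⟨k, by simp⟩) (Or.inr k.lt_succ_self)
    have hstep : Measurable fun q : ℝ × ℝ × ℝ × ℝ =>
        max (q.1 - q.2.1) 0 + if max (q.1 - q.2.1) 0 < α⁻¹ * q.2.2.2 then q.2.2.1 else 0 := by
      refine Measurable.add (by fun_prop) (Measurable.ite ?_ (by fun_prop) measurable_const)
      exact measurableSet_lt (by fun_prop) (by fun_prop)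
    convert hstep.comp (h0.prodMk (h1.prodMk (h2.prodMk h3))) using 1
    ext ω
    simp only [embeddedWait, Function.comp_apply]

theorem arrivalTime_measurable_past (hA : ∀ ω, IsCountingPath fun t => A t ω) (k : ℕ) :
    Measurable[driverSigma A V Dt Z (pastIdx k)] (arrivalTime A k) := by
  induction k with
  | zero =>
    have : arrivalTime A 0 = fun _ => 0 := funext fun ω => arrivalTime_zero (hA ω)
    rw [this]
    exact @measurable_const _ _ _ (_) _
  | succ k ih =>
    have : arrivalTime A (k + 1) = fun ω => arrivalTime A k ω + interarrival A k ω :=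
      funext fun ω => arrivalTime_succ k
    rw [this]
    exact @Measurable.add _ _ _ _ _ (_) _ _
      (ih.mono (driverSigma_mono fun p hp => hp.imp id Nat.lt_succ_of_lt) le_rfl)
      (measurable_driverSigma_driver (i := 1) (j := ⟨k, by simp⟩) (Or.inr k.lt_succ_self))

end Embedded

/-! ### The compensator of the effective arrivals -/

section Compensator

variable {Ω : Type*} [MeasurableSpace Ω] {P : Measure Ω} {lam μ α : ℝ} {A : ℝ → Ω → ℕ}
  {V D Dt : ℕ → Ω → ℝ} {Z : ℝ → Ω → ℝ}

theorem IsPoissonQueue.measurable_arrivalTime (hQ : IsPoissonQueue P lam μ α A V Dt Z) (k : ℕ) :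
    Measurable (arrivalTime A k) :=
  (AbandonmentQueue.measurable_arrivalTime hQ.poisson.path k).mono
    hQ.measurableSpace_arrivals_le le_rfl

theorem IsPoissonQueue.measurable_embeddedWait (hQ : IsPoissonQueue P lam μ α A V Dt Z) (k : ℕ) :
    Measurable (embeddedWait A V (fun k ω => α⁻¹ * Dt k ω) Z k) :=
  (embeddedWait_measurable_past k).mono (hQ.driverSigma_le _) le_rfl

theorem IsPoissonQueue.measurable_interarrival (hQ : IsPoissonQueue P lam μ α A V Dt Z) (k : ℕ) :
    Measurable (interarrival A k) :=
  (hQ.measurable_arrivalTime (k + 1)).sub (hQ.measurable_arrivalTime k)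

theorem IsPoissonQueue.measurableSet_servedSet (hQ : IsPoissonQueue P lam μ α A V Dt Z) (k : ℕ) :
    MeasurableSet (servedSet A V (fun k ω => α⁻¹ * Dt k ω) Z k) :=
  measurableSet_lt (((hQ.measurable_embeddedWait k).sub (hQ.measurable_interarrival k)).max
    measurable_const) ((hQ.Dt_measurable k).const_mul _)

theorem IsPoissonQueue.measurable_serveProb_term (hQ : IsPoissonQueue P lam μ α A V Dt Z)
    {F : ℝ → ℝ} (hF : Measurable F) (k : ℕ) :
    Measurable fun p : Ω × ℝ =>
      (Ioc (arrivalTime A k p.1) (arrivalTime A (k + 1) p.1)).indicator (fun u => ENNReal.ofReal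
        (F (max (embeddedWait A V (fun k ω => α⁻¹ * Dt k ω) Z k p.1
          - (u - arrivalTime A k p.1)) 0))) p.2 := by
  have hT : ∀ k, Measurable fun p : Ω × ℝ => arrivalTime A k p.1 := fun k =>
    (hQ.measurable_arrivalTime k).comp measurable_fst
  have hR : Measurable fun p : Ω × ℝ => embeddedWait A V (fun k ω => α⁻¹ * Dt k ω) Z k p.1 :=
    (hQ.measurable_embeddedWait k).comp measurable_fst
  have h1 : Measurable fun p : Ω × ℝ => ENNReal.ofReal
      (F (max (embeddedWait A V (fun k ω => α⁻¹ * Dt k ω) Z k p.1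
        - (p.2 - arrivalTime A k p.1)) 0)) :=
    (hF.comp ((hR.sub (measurable_snd.sub (hT k))).max measurable_const)).ennreal_ofReal
  exact h1.indicator (s := {p : Ω × ℝ |
    p.2 ∈ Ioc (arrivalTime A k p.1) (arrivalTime A (k + 1) p.1)})
    ((measurableSet_lt (hT k) measurable_snd).inter
      (measurableSet_le measurable_snd (hT (k + 1))))

theorem IsPoissonQueue.measurable_serveProb (hQ : IsPoissonQueue P lam μ α A V Dt Z)
    {F : ℝ → ℝ} (hF : Measurable F) :
    Measurable fun p : Ω × ℝ => serveProb A V (fun k ω => α⁻¹ * Dt k ω) Z F p.1 p.2 :=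
  Measurable.tsum fun k => hQ.measurable_serveProb_term hF k

theorem IsPoissonQueue.measurable_served (hQ : IsPoissonQueue P lam μ α A V Dt Z)
    {g : ℝ → ℝ≥0∞} (hg : Measurable g) (k : ℕ) :
    Measurable fun ω => (servedSet A V (fun k ω => α⁻¹ * Dt k ω) Z k).indicator
      (fun ω => g (arrivalTime A (k + 1) ω)) ω :=
  (hg.comp (hQ.measurable_arrivalTime (k + 1))).indicator (hQ.measurableSet_servedSet k)

variable [IsProbabilityMeasure P]

/-- The compensator identity for a single customer. Given the past up to the `k`-th arrival, the
offered waiting time is a function of the next interarrival time alone, and the patience is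
independent of both. -/
theorem IsPoissonQueue.lintegral_served (hQ : IsPoissonQueue P lam μ α A V Dt Z)
    {g : ℝ → ℝ≥0∞} (hg : Measurable g) (k : ℕ) :
    ∫⁻ ω, (servedSet A V (fun k ω => α⁻¹ * Dt k ω) Z k).indicator
        (fun ω => g (arrivalTime A (k + 1) ω)) ω ∂P
      = ENNReal.ofReal lam * ∫⁻ ω, ∫⁻ u in Ioc (arrivalTime A k ω) (arrivalTime A (k + 1) ω),
          g u * ENNReal.ofReal (patienceTail (P.map (Dt 0)) α
            (max (embeddedWait A V (fun k ω => α⁻¹ * Dt k ω) Z k ω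
              - (u - arrivalTime A k ω)) 0)) ∂volume ∂P := by
  set R := embeddedWait A V (fun k ω => α⁻¹ * Dt k ω) Z k with hR
  set F := patienceTail (P.map (Dt 0)) α with hF
  have hFm : Measurable F := measurable_patienceTail
  have hDt : P.map (Dt k) = P.map (Dt 0) := (hQ.Dt_ident k).map_eq
  have := Measure.isProbabilityMeasure_map (μ := P) (hQ.Dt_measurable 0).aemeasurable
  have hTRm := (hQ.measurable_arrivalTime k).prodMk (hQ.measurable_embeddedWait k)
  have hTRpast : Measurable[driverSigma A V Dt Z (pastIdx k)]
      fun ω => (arrivalTime A k ω, R ω) :=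
    (arrivalTime_measurable_past hQ.poisson.path k).prodMk (embeddedWait_measurable_past k)
  -- the patience of the customer is independent of the past and of the interarrival time
  have hindD : IndepFun (fun ω => ((arrivalTime A k ω, R ω), interarrival A k ω)) (Dt k) P := by
    refine hQ.indepFun_driver (S := insert (arrIdx k) (pastIdx k)) (p := patIdx k) ?_ ?_
    · exact (hTRpast.mono (driverSigma_mono (subset_insert _ _)) le_rfl).prodMk
        (measurable_driverSigma_driver (i := 1) (j := ⟨k, by simp⟩) (mem_insert _ _))
    · simp [arrIdx, pastIdx, patIdx]
  have hindT : IndepFun (fun ω => (arrivalTime A k ω, R ω)) (interarrival A k) P :=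
    hQ.indepFun_driver (p := arrIdx k) hTRpast (by simp [arrIdx, pastIdx])
  let f₁ : ((ℝ × ℝ) × ℝ) × ℝ → ℝ≥0∞ :=
    {q : ((ℝ × ℝ) × ℝ) × ℝ | max (q.1.1.2 - q.1.2) 0 < α⁻¹ * q.2}.indicator
      fun q => g (q.1.1.1 + q.1.2)
  have hf₁ : Measurable f₁ := (by fun_prop : Measurable fun q : ((ℝ × ℝ) × ℝ) × ℝ =>
    g (q.1.1.1 + q.1.2)).indicator (measurableSet_lt (by fun_prop) (by fun_prop))
  let f₂ : (ℝ × ℝ) × ℝ → ℝ≥0∞ := fun q =>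
    g (q.1.1 + q.2) * ENNReal.ofReal (F (max (q.1.2 - q.2) 0))
  have hf₂ : Measurable f₂ := by fun_prop
  let f₃ : (ℝ × ℝ) × ℝ → ℝ≥0∞ := fun q => ∫⁻ x in Ioc 0 q.2, f₂ (q.1, x)
  have hf₃ : Measurable f₃ := by
    have : f₃ = fun q => ∫⁻ x, {r : ((ℝ × ℝ) × ℝ) × ℝ | 0 < r.2 ∧ r.2 ≤ r.1.2}.indicator
        (fun r => f₂ (r.1.1, r.2)) (q, x) := by
      ext q
      simp only [f₃]
      rw [← lintegral_indicator measurableSet_Ioc]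
      rfl
    rw [this]
    refine Measurable.lintegral_prod_right' (f := {r : ((ℝ × ℝ) × ℝ) × ℝ |
      0 < r.2 ∧ r.2 ≤ r.1.2}.indicator (fun r => f₂ (r.1.1, r.2))) ?_
    have hs : MeasurableSet {r : ((ℝ × ℝ) × ℝ) × ℝ | 0 < r.2 ∧ r.2 ≤ r.1.2} :=
      (measurableSet_lt measurable_const measurable_snd).inter
        (measurableSet_le measurable_snd (measurable_snd.comp measurable_fst))
    exact (hf₂.comp (by fun_prop)).indicator hs
  calc
    _ = ∫⁻ ω, f₁ (((arrivalTime A k ω, R ω), interarrival A k ω), Dt k ω) ∂P := by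
      refine lintegral_congr fun ω => ?_
      simp only [f₁, indicator, servedSet, embeddedOffer, arrivalTime_succ]
      rfl
    _ = ∫⁻ ω, f₂ ((arrivalTime A k ω, R ω), interarrival A k ω) ∂P := by
      rw [lintegral_comp_of_indepFun hindD (hTRm.prodMk (hQ.measurable_interarrival k))
        (hQ.Dt_measurable k) hf₁, hDt]
      refine lintegral_congr fun ω => ?_
      simp only [f₂]
      rw [hF, ← measure_lt_inv_mul hQ.alpha_pos, ← lintegral_indicator_const]
      · rfl
      · exact measurableSet_lt (by fun_prop) (by fun_prop)
    _ = ∫⁻ ω, ENNReal.ofReal lam * ∫⁻ y, f₃ ((arrivalTime A k ω, R ω), y)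
          ∂(P.map (interarrival A k)) ∂P := by
      rw [lintegral_comp_of_indepFun hindT hTRm (hQ.measurable_interarrival k) hf₂,
        hQ.poisson.law k]
      refine lintegral_congr fun ω => ?_
      exact lintegral_expMeasure_eq_lintegral_compensator hQ.lam_pos
        (f := fun x => f₂ ((arrivalTime A k ω, R ω), x)) (by fun_prop)
    _ = ENNReal.ofReal lam *
          ∫⁻ ω, f₃ ((arrivalTime A k ω, R ω), interarrival A k ω) ∂P := by
      rw [lintegral_const_mul' _ _ ENNReal.ofReal_ne_top,
        lintegral_comp_of_indepFun hindT hTRm (hQ.measurable_interarrival k) hf₃]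
    _ = _ := by
      congr 1
      refine lintegral_congr fun ω => ?_
      rw [arrivalTime_succ, ← setLIntegral_Ioc_comp_add]
      simp [f₃, f₂]

/-- Mean of the effective arrivals, weighted by a function `g` of the arrival epoch. -/
theorem IsPoissonQueue.lintegral_tsum_served (hQ : IsPoissonQueue P lam μ α A V Dt Z)
    {g : ℝ → ℝ≥0∞} (hg : Measurable g) :
    ∫⁻ ω, ∑' k, (servedSet A V (fun k ω => α⁻¹ * Dt k ω) Z k).indicator
        (fun ω => g (arrivalTime A (k + 1) ω)) ω ∂P
      = ENNReal.ofReal lam * ∫⁻ ω, ∫⁻ u, g u * serveProb A V (fun k ω => α⁻¹ * Dt k ω) Z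
          (patienceTail (P.map (Dt 0)) α) ω u ∂volume ∂P := by
  rw [lintegral_tsum fun k => (hQ.measurable_served hg k).aemeasurable]
  simp_rw [hQ.lintegral_served hg, ENNReal.tsum_mul_left]
  congr 1
  have hmeas : ∀ k, Measurable fun p : Ω × ℝ => g p.2 *
      (Ioc (arrivalTime A k p.1) (arrivalTime A (k + 1) p.1)).indicator (fun u => ENNReal.ofReal
        (patienceTail (P.map (Dt 0)) α (max (embeddedWait A V (fun k ω => α⁻¹ * Dt k ω) Z k p.1
          - (u - arrivalTime A k p.1)) 0))) p.2 := fun k =>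
    (hg.comp measurable_snd).mul (hQ.measurable_serveProb_term measurable_patienceTail k)
  simp_rw [serveProb, ← ENNReal.tsum_mul_left]
  symm
  refine (lintegral_congr fun ω => lintegral_tsum fun k => ?_).trans
    ((lintegral_tsum fun k => (hmeas k).lintegral_prod_right'.aemeasurable).trans
      (tsum_congr fun k => lintegral_congr fun ω => ?_))
  · exact ((hmeas k).comp measurable_prodMk_left).aemeasurable
  rw [← lintegral_indicator measurableSet_Ioc]
  refine lintegral_congr fun u => ?_
  simp only [indicator]
  split_ifs <;> simp

/-- Mean of the effective input, weighted by a function `g` of the arrival epoch: the service time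
is independent of the arrival epoch and of the decision to join. -/
theorem IsPoissonQueue.lintegral_tsum_served_mul_service
    (hQ : IsPoissonQueue P lam μ α A V Dt Z) {g : ℝ → ℝ≥0∞} (hg : Measurable g) :
    ∫⁻ ω, ∑' k, (servedSet A V (fun k ω => α⁻¹ * Dt k ω) Z k).indicator
        (fun ω => g (arrivalTime A (k + 1) ω)) ω * ENNReal.ofReal (V k ω) ∂P
      = ENNReal.ofReal (1 / μ) *
        ∫⁻ ω, ∑' k, (servedSet A V (fun k ω => α⁻¹ * Dt k ω) Z k).indicator
          (fun ω => g (arrivalTime A (k + 1) ω)) ω ∂P := by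
  have hm := hQ.measurable_served hg
  have hmV : ∀ k, Measurable fun ω => (servedSet A V (fun k ω => α⁻¹ * Dt k ω) Z k).indicator
      (fun ω => g (arrivalTime A (k + 1) ω)) ω * ENNReal.ofReal (V k ω) := fun k =>
    (hm k).mul (hQ.V_measurable k).ennreal_ofReal
  rw [lintegral_tsum fun k => (hmV k).aemeasurable,
    lintegral_tsum fun k => (hm k).aemeasurable, ← ENNReal.tsum_mul_left]
  refine tsum_congr fun k => ?_
  have hV : ∫⁻ ω, ENNReal.ofReal (V k ω) ∂P = ENNReal.ofReal (1 / μ) := by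
    rw [← ofReal_integral_eq_lintegral_ofReal
      ((hQ.V_ident k).integrable_iff.2 (hQ.V_memLp.integrable one_le_two)) (hQ.V_nonneg k),
      (hQ.V_ident k).integral_eq, hQ.V_mean]
  have hpast : Measurable[driverSigma A V Dt Z (insert (patIdx k) (insert (arrIdx k) (pastIdx k)))]
      fun ω => (((arrivalTime A k ω, embeddedWait A V (fun k ω => α⁻¹ * Dt k ω) Z k ω),
        interarrival A k ω), Dt k ω) := by
    refine (((arrivalTime_measurable_past hQ.poisson.path k).prodMk
      (embeddedWait_measurable_past k)).mono (driverSigma_mono ?_) le_rfl |>.prodMk ?_).prodMk ?_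
    · exact (subset_insert _ _).trans (subset_insert _ _)
    · exact measurable_driverSigma_driver (i := 1) (j := ⟨k, by simp⟩) (mem_insert_of_mem _ (mem_insert _ _))
    · exact measurable_driverSigma_driver (i := 3) (j := ⟨k, by simp⟩) (mem_insert _ _)
  have hind := hQ.indepFun_driver (p := servIdx k) hpast
    (by simp [arrIdx, pastIdx, patIdx, servIdx])
  let f : ((ℝ × ℝ) × ℝ) × ℝ → ℝ≥0∞ :=
    {q : ((ℝ × ℝ) × ℝ) × ℝ | max (q.1.1.2 - q.1.2) 0 < α⁻¹ * q.2}.indicator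
      fun q => g (q.1.1.1 + q.1.2)
  have hf : Measurable f := (by fun_prop : Measurable fun q : ((ℝ × ℝ) × ℝ) × ℝ =>
    g (q.1.1.1 + q.1.2)).indicator (measurableSet_lt (by fun_prop) (by fun_prop))
  have hfeq : (fun ω => (servedSet A V (fun k ω => α⁻¹ * Dt k ω) Z k).indicator
      (fun ω => g (arrivalTime A (k + 1) ω)) ω) = fun ω =>
        f (((arrivalTime A k ω, embeddedWait A V (fun k ω => α⁻¹ * Dt k ω) Z k ω),
          interarrival A k ω), Dt k ω) := by
    ext ω
    simp only [f, indicator, servedSet, embeddedOffer, arrivalTime_succ]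
    rfl
  have h := lintegral_mul_eq_lintegral_mul_lintegral_of_indepFun (hm k)
    (hQ.V_measurable k).ennreal_ofReal (by
      rw [hfeq]
      exact hind.comp hf ENNReal.measurable_ofReal)
  simp only [Pi.mul_apply] at h
  rw [h, hV, mul_comm]

end Compensator

/-! ### Sample paths of the queue -/

section Paths

variable {Ω : Type*} {A : ℝ → Ω → ℕ} {V D : ℕ → Ω → ℝ} {Z : ℝ → Ω → ℝ} {ω : Ω}

/-- An outcome whose path is a path of the queue: every customer eventually arrives, at pairwise
distinct times, service times are nonnegative, and the reflection equation holds. Almost every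
outcome is regular. -/
structure IsRegularOutcome (A : ℝ → Ω → ℕ) (V D : ℕ → Ω → ℝ) (Z : ℝ → Ω → ℝ) (ω : Ω) : Prop where
  path : IsCountingPath fun t => A t ω
  interarrival_pos : ∀ k, 0 < interarrival A k ω
  service_nonneg : ∀ k, 0 ≤ V k ω
  virtualWait : IsVirtualWait A V D Z ω

namespace IsRegularOutcome

variable (h : IsRegularOutcome A V D Z ω)

include h

theorem exists_mem_Ioc {u : ℝ} (hu : 0 < u) :
    ∃ k, u ∈ Ioc (arrivalTime A k ω) (arrivalTime A (k + 1) ω) := by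
  have hle := arrivalTime_le_iff h.path h.interarrival_pos hu.le
  have h1 : u < arrivalTime A (A u ω + 1) ω := by
    rw [← not_le, hle]; omega
  rcases ((hle (A u ω)).2 le_rfl).lt_or_eq with h2 | h2
  · exact ⟨A u ω, h2, h1.le⟩
  · -- at an arrival epoch the interval is the one that ends there
    obtain ⟨k, hk⟩ : ∃ k, A u ω = k + 1 := by
      refine Nat.exists_eq_succ_of_ne_zero fun h0 => ?_
      rw [h0, arrivalTime_zero h.path] at h2
      exact hu.ne h2
    rw [hk] at h2
    refine ⟨k, ?_, h2.ge⟩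
    rw [← h2]
    exact strictMono_arrivalTime h.interarrival_pos k.lt_succ_self

theorem tendsto_left_arrivalTime (k : ℕ) {u : ℝ}
    (hu : u ∈ Ioc (arrivalTime A k ω) (arrivalTime A (k + 1) ω)) :
    Tendsto (fun v => Z v ω) (𝓝[<] u)
        (𝓝 (max (Z (arrivalTime A k ω) ω - (u - arrivalTime A k ω)) 0)) := by
  classical
  exact tendsto_reflection_left (T := fun k => arrivalTime A k ω)
    (c := fun k => if offeredWait A Z k ω < D k ω then V k ω else 0)
    (N := fun t => netInput A V D Z t ω)
    (arrivalTime_zero h.path) (strictMono_arrivalTime h.interarrival_pos)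
    (fun t ht k => arrivalTime_le_iff h.path h.interarrival_pos ht k)
    (fun k => by
      split_ifs
      exacts [h.service_nonneg k, le_rfl])
    (fun t => by simp only [netInput, effInput]) h.virtualWait k hu

theorem offeredWait_eq_max (k : ℕ) :
    offeredWait A Z k ω = max (Z (arrivalTime A k ω) ω - interarrival A k ω) 0 :=
  leftLim_eq_of_tendsto (h.tendsto_left_arrivalTime k
    ⟨strictMono_arrivalTime h.interarrival_pos k.lt_succ_self, le_rfl⟩)

/-- The virtual waiting time at arrival epochs follows the recursion of the embedded queue. -/
theorem eq_embeddedWait (k : ℕ) : Z (arrivalTime A k ω) ω = embeddedWait A V D Z k ω := by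
  classical
  induction k with
  | zero => rw [arrivalTime_zero h.path]; rfl
  | succ k ih =>
    have := (reflection_between_arrivals (T := fun k => arrivalTime A k ω)
      (c := fun k => if offeredWait A Z k ω < D k ω then V k ω else 0)
      (z := fun t => Z t ω) (N := fun t => netInput A V D Z t ω)
      (arrivalTime_zero h.path) (strictMono_arrivalTime h.interarrival_pos)
      (fun t ht k => arrivalTime_le_iff h.path h.interarrival_pos ht k)
      (fun k => by
        split_ifs
        exacts [h.service_nonneg k, le_rfl])
      (fun t => by simp only [netInput, effInput]) h.virtualWait k).2
    simp only [h.offeredWait_eq_max, ih] at this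
    rw [this, embeddedWait, interarrival]

theorem offeredWait_eq (k : ℕ) : offeredWait A Z k ω = embeddedOffer A V D Z k ω := by
  rw [h.offeredWait_eq_max, h.eq_embeddedWait, embeddedOffer]

theorem tendsto_left {u : ℝ} (hu : 0 < u) :
    Tendsto (fun v => Z v ω) (𝓝[<] u) (𝓝 (leftLimit Z u ω)) := by
  obtain ⟨k, hk⟩ := h.exists_mem_Ioc hu
  have := h.tendsto_left_arrivalTime k hk
  rwa [leftLimit, leftLim_eq_of_tendsto this]

theorem wait_nonneg {t : ℝ} (ht : 0 ≤ t) : 0 ≤ Z t ω := by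
  classical
  have := (reflection_bounds (z := fun t => Z t ω) (N := fun t => netInput A V D Z t ω)
    (fun u _ => ?_) h.virtualWait ht).2.1 t ⟨ht, le_rfl⟩
  · simpa using this
  · simp only [netInput, neg_sub, tsub_le_iff_right, le_add_iff_nonneg_right, effInput]
    refine Finset.sum_nonneg fun k _ => ?_
    split_ifs
    exacts [h.service_nonneg k, le_rfl]

theorem serveProb_eq (F : ℝ → ℝ) {u : ℝ} (hu : 0 < u) :
    serveProb A V D Z F ω u = ENNReal.ofReal (F (leftLimit Z u ω)) := by
  obtain ⟨k, hk⟩ := h.exists_mem_Ioc hu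
  have hdisj := (strictMono_arrivalTime h.interarrival_pos).monotone.pairwise_disjoint_on_Ioc_succ
  have hnot : ∀ j, j ≠ k → u ∉ Ioc (arrivalTime A j ω) (arrivalTime A (j + 1) ω) :=
    fun j hj hmem => disjoint_left.1 (hdisj hj) hmem hk
  rw [serveProb, tsum_eq_single k fun j hj => indicator_of_notMem (hnot j hj) _,
    indicator_of_mem hk, leftLimit,
    leftLim_eq_of_tendsto (h.tendsto_left_arrivalTime k hk), h.eq_embeddedWait]

open Classical in
/-- Increments over `(a, b]` of a sum over the served customers, as a series over all customers. -/
theorem sum_range_sub_sum_range {w : ℕ → ℝ} (hw : ∀ k, 0 ≤ w k) {a b : ℝ} (ha : 0 ≤ a)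
    (hab : a ≤ b) :
    0 ≤ (∑ k ∈ Finset.range (A b ω), if offeredWait A Z k ω < D k ω then w k else 0)
        - ∑ k ∈ Finset.range (A a ω), (if offeredWait A Z k ω < D k ω then w k else 0) ∧
    ENNReal.ofReal ((∑ k ∈ Finset.range (A b ω), if offeredWait A Z k ω < D k ω then w k else 0)
        - ∑ k ∈ Finset.range (A a ω), if offeredWait A Z k ω < D k ω then w k else 0)
      = ∑' k, (servedSet A V D Z k).indicator
          (fun ω => (Ioc a b).indicator (fun _ => 1) (arrivalTime A (k + 1) ω)) ω
            * ENNReal.ofReal (w k) := by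
  have hmono : A a ω ≤ A b ω := h.path.mono ha (ha.trans hab) hab
  have hnn : ∀ k, 0 ≤ (if offeredWait A Z k ω < D k ω then w k else 0) := fun k => by
    split_ifs
    exacts [hw k, le_rfl]
  rw [← Finset.sum_Ico_eq_sub _ hmono]
  refine ⟨Finset.sum_nonneg fun k _ => hnn k, ?_⟩
  rw [ENNReal.ofReal_sum_of_nonneg fun k _ => hnn k]
  have hmem : ∀ k, arrivalTime A (k + 1) ω ∈ Ioc a b ↔ k ∈ Finset.Ico (A a ω) (A b ω) := by
    intro k
    rw [mem_Ioc, ← not_le, arrivalTime_le_iff h.path h.interarrival_pos ha,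
      arrivalTime_le_iff h.path h.interarrival_pos (ha.trans hab), Finset.mem_Ico]
    omega
  rw [tsum_eq_sum (s := Finset.Ico (A a ω) (A b ω))]
  · refine Finset.sum_congr rfl fun k hk => ?_
    by_cases hs : embeddedOffer A V D Z k ω < D k ω
    · have : ω ∈ servedSet A V D Z k := hs
      simp [h.offeredWait_eq, hs, indicator_of_mem this, indicator_of_mem ((hmem k).2 hk)]
    · have : ω ∉ servedSet A V D Z k := hs
      simp [h.offeredWait_eq, hs, indicator_of_notMem this]
  · intro k hk
    have : arrivalTime A (k + 1) ω ∉ Ioc a b := fun hmem' => hk ((hmem k).1 hmem')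
    simp [indicator, this]

end IsRegularOutcome

theorem IsPoissonQueue.ae_isRegularOutcome [MeasurableSpace Ω] {P : Measure Ω} {lam μ α : ℝ}
    {Dt : ℕ → Ω → ℝ} (hQ : IsPoissonQueue P lam μ α A V Dt Z) :
    ∀ᵐ ω ∂P, IsRegularOutcome A V (fun k ω => α⁻¹ * Dt k ω) Z ω := by
  have hpos : ∀ᵐ ω ∂P, ∀ k, 0 < interarrival A k ω := ae_all_iff.2 fun k => by
    have h0 := expMeasure_Iic_zero hQ.lam_pos
    rw [← hQ.poisson.law k, Measure.map_apply (hQ.measurable_interarrival k) measurableSet_Iic]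
      at h0
    refine measure_mono_null (fun ω hω => ?_) h0
    exact not_lt.1 (show ¬ 0 < interarrival A k ω from hω)
  filter_upwards [hpos, ae_all_iff.2 hQ.V_nonneg, hQ.Z_virtualWait] with ω h1 h2 h3
  exact ⟨hQ.poisson.path ω, h1, h2, h3⟩

end Paths

/-! ### Means of increments -/

section Means

/-- Transfer of an extended nonnegative mean to a Bochner integral. -/
theorem integrable_and_integral_eq_toReal {Ω : Type*} [MeasurableSpace Ω] {P : Measure Ω}
    {f : Ω → ℝ} {H : Ω → ℝ≥0∞} (h0 : 0 ≤ᵐ[P] f) (hH : AEMeasurable H P)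
    (hf : (fun ω => ENNReal.ofReal (f ω)) =ᵐ[P] H) (hfin : ∫⁻ ω, H ω ∂P ≠ ∞) :
    Integrable f P ∧ ∫ ω, f ω ∂P = (∫⁻ ω, H ω ∂P).toReal := by
  have heq : f =ᵐ[P] fun ω => (H ω).toReal := by
    filter_upwards [h0, hf] with ω h1 h2
    rw [← h2, ENNReal.toReal_ofReal h1]
  have hint : Integrable f P := (integrable_toReal_of_lintegral_ne_top hH hfin).congr heq.symm
  refine ⟨hint, ?_⟩
  rw [integral_eq_lintegral_of_nonneg_ae h0 hint.aestronglyMeasurable, lintegral_congr_ae hf]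

variable {Ω : Type*} [MeasurableSpace Ω] {P : Measure Ω} {lam μ α : ℝ}
  {A : ℝ → Ω → ℕ} {V Dt : ℕ → Ω → ℝ} {Z : ℝ → Ω → ℝ}

/-- The expected integral over `(a, b]` of the probability to be served on arrival. -/
noncomputable def meanServe (P : Measure Ω) (α : ℝ) (A : ℝ → Ω → ℕ) (V Dt : ℕ → Ω → ℝ)
    (Z : ℝ → Ω → ℝ) (a b : ℝ) : ℝ≥0∞ :=
  ∫⁻ ω, ∫⁻ u in Ioc a b, serveProb A V (fun k ω => α⁻¹ * Dt k ω) Z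
    (patienceTail (P.map (Dt 0)) α) ω u ∂volume ∂P

theorem IsPoissonQueue.ae_setLIntegral_serveProb (hQ : IsPoissonQueue P lam μ α A V Dt Z)
    {a b : ℝ} (ha : 0 ≤ a) :
    ∀ᵐ ω ∂P, ∫⁻ u in Ioc a b, serveProb A V (fun k ω => α⁻¹ * Dt k ω) Z
        (patienceTail (P.map (Dt 0)) α) ω u
      = ∫⁻ u in Ioc a b, ENNReal.ofReal (patienceTail (P.map (Dt 0)) α (leftLimit Z u ω)) := by
  filter_upwards [hQ.ae_isRegularOutcome] with ω h
  exact setLIntegral_congr_fun measurableSet_Ioc fun u hu => h.serveProb_eq _ (ha.trans_lt hu.1)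

theorem IsPoissonQueue.meanServe_ne_top [IsProbabilityMeasure P]
    (hQ : IsPoissonQueue P lam μ α A V Dt Z)
    {a b : ℝ} (ha : 0 ≤ a) : meanServe P α A V Dt Z a b ≠ ∞ := by
  refine ne_top_of_le_ne_top (b := ENNReal.ofReal (b - a)) ENNReal.ofReal_ne_top ?_
  rw [meanServe, lintegral_congr_ae (hQ.ae_setLIntegral_serveProb ha)]
  calc _ ≤ ∫⁻ ω, ∫⁻ u in Ioc a b, 1 ∂volume ∂P := by
        gcongr
        exact ENNReal.ofReal_le_one.2 (patienceTail_le_one _)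
    _ = _ := by simp

theorem IsPoissonQueue.lintegral_served_Ioc [IsProbabilityMeasure P]
    (hQ : IsPoissonQueue P lam μ α A V Dt Z) (a b : ℝ) :
    ∫⁻ ω, ∑' k, (servedSet A V (fun k ω => α⁻¹ * Dt k ω) Z k).indicator
        (fun ω => (Ioc a b).indicator (fun _ => 1) (arrivalTime A (k + 1) ω)) ω ∂P
      = ENNReal.ofReal lam * meanServe P α A V Dt Z a b := by
  rw [hQ.lintegral_tsum_served (g := (Ioc a b).indicator fun _ => 1)
    (measurable_const.indicator measurableSet_Ioc), meanServe]
  congr 1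
  refine lintegral_congr fun ω => ?_
  rw [← lintegral_indicator measurableSet_Ioc]
  refine lintegral_congr fun u => ?_
  simp only [indicator]
  split_ifs <;> simp

theorem IsPoissonQueue.effArrivals_increment [IsProbabilityMeasure P]
    (hQ : IsPoissonQueue P lam μ α A V Dt Z)
    {a b : ℝ} (ha : 0 ≤ a) (hab : a ≤ b) :
    Integrable (fun ω => effArrivals A (fun k ω => α⁻¹ * Dt k ω) Z b ω
        - effArrivals A (fun k ω => α⁻¹ * Dt k ω) Z a ω) P ∧
      ∫ ω, (effArrivals A (fun k ω => α⁻¹ * Dt k ω) Z b ω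
        - effArrivals A (fun k ω => α⁻¹ * Dt k ω) Z a ω) ∂P
        = lam * (meanServe P α A V Dt Z a b).toReal := by
  have hinc := hQ.ae_isRegularOutcome.mono fun ω h =>
    h.sum_range_sub_sum_range (w := fun _ => 1) (fun _ => zero_le_one) ha hab
  have hL := hQ.lintegral_served_Ioc a b
  have key := integrable_and_integral_eq_toReal (P := P)
    (f := fun ω => effArrivals A (fun k ω => α⁻¹ * Dt k ω) Z b ω
        - effArrivals A (fun k ω => α⁻¹ * Dt k ω) Z a ω)
    (H := fun ω => ∑' k, (servedSet A V (fun k ω => α⁻¹ * Dt k ω) Z k).indicator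
        (fun ω => (Ioc a b).indicator (fun _ => 1) (arrivalTime A (k + 1) ω)) ω)
    (hinc.mono fun ω h => h.1)
    (Measurable.tsum fun k => hQ.measurable_served
      (measurable_const.indicator measurableSet_Ioc) k).aemeasurable
    (hinc.mono fun ω h => by
      have h2 := h.2
      simp only [ENNReal.ofReal_one, mul_one] at h2
      exact h2)
    (by rw [hL]; exact ENNReal.mul_ne_top ENNReal.ofReal_ne_top (hQ.meanServe_ne_top ha))
  rwa [hL, ENNReal.toReal_mul, ENNReal.toReal_ofReal hQ.lam_pos.le] at key

theorem IsPoissonQueue.effInput_increment [IsProbabilityMeasure P]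
    (hQ : IsPoissonQueue P lam μ α A V Dt Z)
    {a b : ℝ} (ha : 0 ≤ a) (hab : a ≤ b) :
    Integrable (fun ω => effInput A V (fun k ω => α⁻¹ * Dt k ω) Z b ω
        - effInput A V (fun k ω => α⁻¹ * Dt k ω) Z a ω) P ∧
      ∫ ω, (effInput A V (fun k ω => α⁻¹ * Dt k ω) Z b ω
        - effInput A V (fun k ω => α⁻¹ * Dt k ω) Z a ω) ∂P
        = lam / μ * (meanServe P α A V Dt Z a b).toReal := by
  have hinc := hQ.ae_isRegularOutcome.mono fun ω h =>
    h.sum_range_sub_sum_range (w := fun k => V k ω) h.service_nonneg ha hab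
  have hg : Measurable ((Ioc a b).indicator fun _ => (1 : ℝ≥0∞)) :=
    measurable_const.indicator measurableSet_Ioc
  have hL := (hQ.lintegral_tsum_served_mul_service hg).trans
    (congrArg (ENNReal.ofReal (1 / μ) * ·) (hQ.lintegral_served_Ioc a b))
  have key := integrable_and_integral_eq_toReal (P := P)
    (f := fun ω => effInput A V (fun k ω => α⁻¹ * Dt k ω) Z b ω
        - effInput A V (fun k ω => α⁻¹ * Dt k ω) Z a ω)
    (hinc.mono fun ω h => h.1)
    (Measurable.tsum fun k => (hQ.measurable_served hg k).mul
      (hQ.V_measurable k).ennreal_ofReal).aemeasurable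
    (hinc.mono fun ω h => h.2)
    (by
      refine ne_of_eq_of_ne hL ?_
      exact ENNReal.mul_ne_top ENNReal.ofReal_ne_top
        (ENNReal.mul_ne_top ENNReal.ofReal_ne_top (hQ.meanServe_ne_top ha)))
  refine ⟨key.1, key.2.trans ((congrArg ENNReal.toReal hL).trans ?_)⟩
  rw [ENNReal.toReal_mul, ENNReal.toReal_mul, ENNReal.toReal_ofReal hQ.lam_pos.le,
    ENNReal.toReal_ofReal (one_div_nonneg.2 hQ.mu_pos.le)]
  ring

theorem IsPoissonQueue.netInput_increment [IsProbabilityMeasure P]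
    (hQ : IsPoissonQueue P lam μ α A V Dt Z)
    {a b : ℝ} (ha : 0 ≤ a) (hab : a ≤ b) :
    Integrable (fun ω => netInput A V (fun k ω => α⁻¹ * Dt k ω) Z b ω
        - netInput A V (fun k ω => α⁻¹ * Dt k ω) Z a ω) P ∧
      ∫ ω, (netInput A V (fun k ω => α⁻¹ * Dt k ω) Z b ω
        - netInput A V (fun k ω => α⁻¹ * Dt k ω) Z a ω) ∂P
        = lam / μ * (meanServe P α A V Dt Z a b).toReal - (b - a) := by
  obtain ⟨h1, h2⟩ := hQ.effInput_increment ha hab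
  have h3 : (fun ω => netInput A V (fun k ω => α⁻¹ * Dt k ω) Z b ω
        - netInput A V (fun k ω => α⁻¹ * Dt k ω) Z a ω)
      = fun ω => (effInput A V (fun k ω => α⁻¹ * Dt k ω) Z b ω
        - effInput A V (fun k ω => α⁻¹ * Dt k ω) Z a ω) - (b - a) := by
    ext ω
    simp only [netInput]
    ring
  rw [h3, integral_sub h1 (integrable_const _), h2]
  exact ⟨h1.sub (integrable_const _), by simp⟩

theorem IsPoissonQueue.ae_intervalIntegrable (hQ : IsPoissonQueue P lam μ α A V Dt Z)
    {a b : ℝ} (ha : 0 ≤ a) (hab : a ≤ b) :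
    ∀ᵐ ω ∂P, IntervalIntegrable
      (fun u => patienceTail (P.map (Dt 0)) α (leftLimit Z u ω)) volume a b := by
  filter_upwards [hQ.ae_isRegularOutcome] with ω h
  rw [intervalIntegrable_iff_integrableOn_Ioc_of_le hab]
  have hm : Measurable fun u => (serveProb A V (fun k ω => α⁻¹ * Dt k ω) Z
      (patienceTail (P.map (Dt 0)) α) ω u).toReal :=
    ((hQ.measurable_serveProb measurable_patienceTail).comp measurable_prodMk_left).ennreal_toReal
  refine Integrable.of_bound (C := 1) (hm.aestronglyMeasurable.congr ?_)
    (ae_of_all _ fun u => ?_)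
  · filter_upwards [ae_restrict_mem measurableSet_Ioc] with u hu
    rw [h.serveProb_eq _ (ha.trans_lt hu.1), ENNReal.toReal_ofReal (patienceTail_nonneg _)]
  · rw [Real.norm_of_nonneg (patienceTail_nonneg _)]
    exact patienceTail_le_one _

theorem IsPoissonQueue.integral_patienceTail [IsProbabilityMeasure P]
    (hQ : IsPoissonQueue P lam μ α A V Dt Z)
    {a b : ℝ} (ha : 0 ≤ a) (hab : a ≤ b) :
    Integrable (fun ω => ∫ u in a..b, patienceTail (P.map (Dt 0)) α (leftLimit Z u ω)) P ∧
      ∫ ω, (∫ u in a..b, patienceTail (P.map (Dt 0)) α (leftLimit Z u ω)) ∂P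
        = (meanServe P α A V Dt Z a b).toReal := by
  refine integrable_and_integral_eq_toReal
    (ae_of_all _ fun ω => intervalIntegral.integral_nonneg hab fun u _ => patienceTail_nonneg _)
    (hQ.measurable_serveProb measurable_patienceTail).lintegral_prod_right'.aemeasurable
    ?_ (hQ.meanServe_ne_top ha)
  filter_upwards [hQ.ae_setLIntegral_serveProb (b := b) ha, hQ.ae_intervalIntegrable ha hab]
    with ω h1 h2
  rw [h1, intervalIntegral.integral_of_le hab, ofReal_integral_eq_lintegral_ofReal
    ((intervalIntegrable_iff_integrableOn_Ioc_of_le hab).1 h2)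
    (ae_of_all _ fun u => patienceTail_nonneg _)]

end Means

/-! ### The stationary queue -/

section Stationary

variable {Ω : Type*} [MeasurableSpace Ω] {P : Measure Ω} {lam μ α : ℝ}
  {A : ℝ → Ω → ℕ} {V Dt : ℕ → Ω → ℝ} {Z : ℝ → Ω → ℝ}

theorem StrictlyStationary.identDistrib (hS : StrictlyStationary Z P) (v : ℝ) :
    IdentDistrib (Z v) (Z 0) P P := by
  have := (hS 1 (fun _ => 0) v).comp (measurable_pi_apply 0)
  simpa [Function.comp_def] using this

theorem IsPoissonQueue.continuousOn_patienceTail (hQ : IsPoissonQueue P lam μ α A V Dt Z) :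
    ContinuousOn (patienceTail (P.map (Dt 0)) α) (Ici 0) :=
  continuousOn_const.sub (hQ.Dt_cdf.continuousOn.comp (by fun_prop)
    fun _ hx => mul_nonneg hQ.alpha_pos.le hx)

/-- Wherever the stationary process has a left limit almost surely, the mean acceptance probability
given that left limit is the one given the value at time `0`: by stationarity it is so along a
sequence of earlier times, and the patience tail is bounded and continuous on `[0, ∞)`. -/
theorem IsPoissonQueue.integral_patienceTail_leftLimit [IsProbabilityMeasure P]
    (hQ : IsPoissonQueue P lam μ α A V Dt Z)
    (hS : StrictlyStationary Z P) {u : ℝ}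
    (hu : ∀ᵐ ω ∂P, ∃ z : ℝ, Tendsto (fun v => Z v ω) (𝓝[<] u) (𝓝 z)) :
    Integrable (fun ω => patienceTail (P.map (Dt 0)) α (leftLimit Z u ω)) P ∧
      ∫ ω, patienceTail (P.map (Dt 0)) α (leftLimit Z u ω) ∂P
        = ∫ ω, patienceTail (P.map (Dt 0)) α (Z 0 ω) ∂P := by
  set F := patienceTail (P.map (Dt 0)) α with hF
  have hFm : Measurable F := measurable_patienceTail
  have hseq : Tendsto (fun n : ℕ => u - 1 / ((n : ℝ) + 1)) atTop (𝓝[<] u) := by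
    refine tendsto_nhdsWithin_iff.2 ⟨?_, Eventually.of_forall fun n => ?_⟩
    · simpa using tendsto_const_nhds.sub (tendsto_one_div_add_atTop_nhds_zero_nat (𝕜 := ℝ))
    · have : (0 : ℝ) < 1 / ((n : ℝ) + 1) := by positivity
      simp only [mem_Iio]
      linarith
  have hnn0 : ∀ᵐ ω ∂P, Z 0 ω ∈ Ici (0 : ℝ) :=
    hQ.ae_isRegularOutcome.mono fun ω h => h.wait_nonneg le_rfl
  have hnn : ∀ᵐ ω ∂P, ∀ n : ℕ, Z (u - 1 / ((n : ℝ) + 1)) ω ∈ Ici (0 : ℝ) :=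
    ae_all_iff.2 fun n => (hS.identDistrib _).symm.ae_mem_snd measurableSet_Ici hnn0
  have hlim : ∀ᵐ ω ∂P, Tendsto (fun n : ℕ => F (Z (u - 1 / ((n : ℝ) + 1)) ω)) atTop
      (𝓝 (F (leftLimit Z u ω))) := by
    filter_upwards [hu, hnn] with ω ⟨z, hz⟩ hn
    have hzseq := hz.comp hseq
    have hz0 : z ∈ Ici (0 : ℝ) := isClosed_Ici.mem_of_tendsto hzseq (Eventually.of_forall hn)
    rw [leftLimit, leftLim_eq_of_tendsto hz]
    exact (hQ.continuousOn_patienceTail z hz0).tendsto.comp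
      (tendsto_nhdsWithin_iff.2 ⟨hzseq, Eventually.of_forall hn⟩)
  have hmeas : ∀ n : ℕ, AEStronglyMeasurable (fun ω => F (Z (u - 1 / ((n : ℝ) + 1)) ω)) P :=
    fun n => (hFm.comp_aemeasurable (hS.identDistrib _).aemeasurable_fst).aestronglyMeasurable
  have hbound : ∀ x, ‖F x‖ ≤ 1 := fun x => by
    rw [Real.norm_of_nonneg (patienceTail_nonneg _)]
    exact patienceTail_le_one _
  refine ⟨Integrable.of_bound (aestronglyMeasurable_of_tendsto_ae atTop hmeas hlim) 1
    (ae_of_all _ fun ω => hbound _), ?_⟩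
  have hdct := tendsto_integral_of_dominated_convergence (fun _ => (1 : ℝ)) hmeas
    (integrable_const _) (fun n => ae_of_all _ fun ω => hbound _) hlim
  refine tendsto_nhds_unique hdct ?_
  have hconst : ∀ n : ℕ, ∫ ω, F (Z (u - 1 / ((n : ℝ) + 1)) ω) ∂P = ∫ ω, F (Z 0 ω) ∂P :=
    fun n => ((hS.identDistrib _).comp hFm).integral_eq
  simp only [hconst]
  exact tendsto_const_nhds

theorem IsPoissonQueue.meanServe_of_stationary [IsProbabilityMeasure P]
    (hQ : IsPoissonQueue P lam μ α A V Dt Z)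
    (hS : StrictlyStationary Z P) {a b : ℝ} (ha : 0 ≤ a) (hab : a ≤ b) :
    (meanServe P α A V Dt Z a b).toReal
      = (b - a) * ∫ ω, patienceTail (P.map (Dt 0)) α (Z 0 ω) ∂P := by
  have hmean : ∀ u ∈ Ioc a b, ∫⁻ ω, serveProb A V (fun k ω => α⁻¹ * Dt k ω) Z
      (patienceTail (P.map (Dt 0)) α) ω u ∂P
        = ENNReal.ofReal (∫ ω, patienceTail (P.map (Dt 0)) α (Z 0 ω) ∂P) := by
    intro u hu
    have hu0 := ha.trans_lt hu.1
    obtain ⟨h1, h2⟩ := hQ.integral_patienceTail_leftLimit hS (u := u)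
      (hQ.ae_isRegularOutcome.mono fun ω h => ⟨_, h.tendsto_left hu0⟩)
    rw [← h2, ofReal_integral_eq_lintegral_ofReal h1 (ae_of_all _ fun ω => patienceTail_nonneg _)]
    exact lintegral_congr_ae (hQ.ae_isRegularOutcome.mono fun ω h => h.serveProb_eq _ hu0)
  rw [meanServe, lintegral_lintegral_swap
      (hQ.measurable_serveProb measurable_patienceTail).aemeasurable,
    setLIntegral_congr_fun measurableSet_Ioc hmean, setLIntegral_const, Real.volume_Ioc,
    ENNReal.toReal_mul, ENNReal.toReal_ofReal (sub_nonneg.2 hab),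
    ENNReal.toReal_ofReal (integral_nonneg fun ω => patienceTail_nonneg _), mul_comm]

end Stationary

end AbandonmentQueue

theorem mainTheorem12 {Ω : Type*} [MeasurableSpace Ω] (P : Measure Ω) [IsProbabilityMeasure P]
    (lam μ α : ℝ) (A : ℝ → Ω → ℕ) (V Dt : ℕ → Ω → ℝ) (Z : ℝ → Ω → ℝ)
    (D : ℕ → Ω → ℝ) (hD : D = fun k ω => α⁻¹ * Dt k ω)
    (Fbar : ℝ → ℝ) (hFbar : Fbar = AbandonmentQueue.patienceTail (P.map (Dt 0)) α)
    (A₀ N : ℝ → Ω → ℝ) (hA₀ : A₀ = AbandonmentQueue.effArrivals A D Z)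
    (hN : N = AbandonmentQueue.netInput A V D Z)
    (hQ : AbandonmentQueue.IsPoissonQueue P lam μ α A V Dt Z) :
    (∀ s t : ℝ, 0 ≤ s → s ≤ t →
      Integrable (fun ω => A₀ t ω - A₀ (t - s) ω) P ∧
      Integrable (fun ω => N t ω - N (t - s) ω) P ∧
      (∀ᵐ ω ∂P, IntervalIntegrable
        (fun u => Fbar (AbandonmentQueue.leftLimit Z u ω)) volume (t - s) t) ∧
      Integrable (fun ω => ∫ u in (t - s)..t, Fbar (AbandonmentQueue.leftLimit Z u ω)) P ∧
      ∫ ω, (A₀ t ω - A₀ (t - s) ω) ∂P =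
        lam * ∫ ω, (∫ u in (t - s)..t, Fbar (AbandonmentQueue.leftLimit Z u ω)) ∂P ∧
      ∫ ω, (N t ω - N (t - s) ω) ∂P =
        lam / μ * ∫ ω, (∫ u in (t - s)..t, Fbar (AbandonmentQueue.leftLimit Z u ω)) ∂P - s) ∧
    (AbandonmentQueue.StrictlyStationary Z P →
      (∀ᵐ ω ∂P, ∃ z : ℝ, Tendsto (fun u => Z u ω) (𝓝[<] 0) (𝓝 z)) →
      Integrable (fun ω => Fbar (AbandonmentQueue.leftLimit Z 0 ω)) P ∧
      ∀ s t : ℝ, 0 ≤ s → s ≤ t →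
        ∫ ω, (A₀ t ω - A₀ (t - s) ω) ∂P =
          lam * s * ∫ ω, Fbar (AbandonmentQueue.leftLimit Z 0 ω) ∂P ∧
        ∫ ω, (N t ω - N (t - s) ω) ∂P =
          (lam / μ * ∫ ω, Fbar (AbandonmentQueue.leftLimit Z 0 ω) ∂P - 1) * s) := by
  subst hD hFbar hA₀ hN
  refine ⟨fun s t hs hst => ?_, fun hS hleft => ?_⟩
  · have ha : 0 ≤ t - s := sub_nonneg.2 hst
    have hab : t - s ≤ t := sub_le_self t hs
    obtain ⟨h1, h2⟩ := hQ.effArrivals_increment ha hab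
    obtain ⟨h3, h4⟩ := hQ.netInput_increment ha hab
    obtain ⟨h5, h6⟩ := hQ.integral_patienceTail ha hab
    refine ⟨h1, h3, hQ.ae_intervalIntegrable ha hab, h5, ?_, ?_⟩
    · rw [h2, h6]
    · rw [h4, h6, sub_sub_cancel]
  · obtain ⟨h1, h2⟩ := hQ.integral_patienceTail_leftLimit hS hleft
    refine ⟨h1, fun s t hs hst => ?_⟩
    have ha : 0 ≤ t - s := sub_nonneg.2 hst
    have hab : t - s ≤ t := sub_le_self t hs
    rw [(hQ.effArrivals_increment ha hab).2, (hQ.netInput_increment ha hab).2,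
      hQ.meanServe_of_stationary hS ha hab, h2, sub_sub_cancel]
    constructor <;> ring
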